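/- Let $G$ be a finite group. Then there exist a finite group $\widetilde G$ and a surjective group homomorphism $\widetilde G \to G$, with kernel $N$, such that for every finite group $S$ and every injective group homomorphism $\iota\colon G \hookrightarrow S$ the following two conditions are equivalent: 1. The short exact sequence $1 \to N \to \widetilde G \to G \to 1$ is the pullback along $\iota$ of some short exact sequence of groups $1 \to N \to \widetilde S \to S \to 1$ with the same kernel $N$; that is, there is an isomorphism from $\widetilde G$ onto the fibre product $\widetilde S \times_S G$ that is compatible with the inclusions of $N$ and with the projections to $G$. 2. There is a group homomorphism $r\colon S \to G$ with $r \circ \iota = \mathrm{id}_G$. Furthermore, the only subgroup of $\widetilde G$ that is isomorphic to $N$ is $N$ itself. -/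

import Mathlib

universe u v

/-- The pullback of a group extension `1 → N → E → S → 1` along a homomorphism `ι : G →* S`: the
extension `1 → N → E ×_S G → G → 1`, where `E ×_S G ≤ E × G` is the subgroup of all `(e, g)` such
that the image of `e` in `S` is `ι g`, the inclusion of `N` is `n ↦ (n, 1)`, and the projection to
`G` is `(e, g) ↦ g`. -/
def GroupExtension.pullback {N E S G : Type*} [Group N] [Group E] [Group S] [Group G]
    (X : GroupExtension N E S) (ι : G →* S) :
    GroupExtension N
      ((X.rightHom.comp (MonoidHom.fst E G)).eqLocus (ι.comp (MonoidHom.snd E G))) G where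
  inl := (X.inl.prod (1 : N →* G)).codRestrict
    ((X.rightHom.comp (MonoidHom.fst E G)).eqLocus (ι.comp (MonoidHom.snd E G)))
    (fun n => by
      change X.rightHom (X.inl n) = ι 1
      simp)
  rightHom := (MonoidHom.snd E G).comp (Subgroup.subtype _)
  inl_injective := fun a b h => X.inl_injective (congrArg (fun z => z.1.1) h)
  range_inl_eq_ker_rightHom := by
    ext ⟨⟨e, g⟩, h⟩
    constructor
    · rintro ⟨n, hn⟩
      exact (congrArg (fun z => z.1.2) hn).symm
    · intro hg
      have hg' : g = 1 := hg
      have he : X.rightHom e = ι g := h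
      have hk : e ∈ X.rightHom.ker := by
        rw [MonoidHom.mem_ker, he, hg', map_one]
      rw [← X.range_inl_eq_ker_rightHom] at hk
      obtain ⟨n, hn⟩ := hk
      exact ⟨n, Subtype.ext (Prod.ext hn hg'.symm)⟩
  rightHom_surjective := fun g => by
    obtain ⟨e, he⟩ := X.rightHom_surjective (ι g)
    exact ⟨⟨(e, g), he⟩, rfl⟩

/-- The extension `X` of `G` is a pullback of the extension `Y` of `S` along `ι : G →* S`, both
having the same kernel `N`: `X` is equivalent (by an isomorphism of the middle groups which is
compatible with the maps from `N` and to `G`) to the fibre product extension. -/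
def GroupExtension.IsPullbackOf {N E F S G : Type*} [Group N] [Group E] [Group F] [Group S]
    [Group G] (X : GroupExtension N E G) (Y : GroupExtension N F S) (ι : G →* S) : Prop :=
  Nonempty (X.Equiv (Y.pullback ι))

/-! A retraction `r` gives condition 1 by pulling the extension back along `r`. For the converse,
take `N` so rigid that `Aut N` has a homomorphism `ρ` to `G` killing inner automorphisms, and a
split extension whose action on `N` is a section of `ρ`. If it is pulled back from `St`, then `ρ` of
the conjugation action of `St` on `N` descends to a retraction `S →* G`. Here `N` encodes the
coloured Cayley graph of `G`, loops included: automorphisms of `N` permute the torus weights of each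
colour (`exists_weight_apply_eq`), so they act on vertices by left translations
(`exists_tor_apply_eq`). Uniqueness of `N` follows from coprimality of its order to that of `G`. -/

namespace GroupExtension

/-- An extension pulled back from a retract is pulled back from the ambient group. -/
theorem isPullbackOf_pullback_of_comp_eq_id {N E S G : Type*} [Group N] [Group E] [Group S]
    [Group G] (X : GroupExtension N E G) (ι : G →* S) (r : S →* G)
    (hr : r.comp ι = MonoidHom.id G) : X.IsPullbackOf (X.pullback r) ι := by
  have hrι (g : G) : r (ι g) = g := DFunLike.congr_fun hr g
  refine ⟨{ toFun := fun e => ⟨(⟨(e, ι (X.rightHom e)), (hrι _).symm⟩, X.rightHom e), rfl⟩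
            invFun := fun z => z.1.1.1.1
            left_inv := fun e => rfl
            right_inv := ?_
            map_mul' := ?_
            inl_comm := ?_
            rightHom_comm := rfl }⟩
  · rintro ⟨⟨⟨⟨e, s⟩, hs⟩, g⟩, hg⟩
    have hs' : X.rightHom e = r s := hs
    have hg' : s = ι g := hg
    have he : X.rightHom e = g := by rw [hs', hg', hrι]
    subst he hg'
    rfl
  · intro a b
    apply Subtype.ext
    refine Prod.ext (Subtype.ext (Prod.ext rfl ?_)) ?_ <;> simp
  · funext n
    apply Subtype.ext
    refine Prod.ext (Subtype.ext (Prod.ext rfl ?_)) ?_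
    · change ι (X.rightHom (X.inl n)) = 1
      simp
    · exact X.rightHom_inl n

theorem conjAct_inl {N E G : Type*} [Group N] [Group E] [Group G] (X : GroupExtension N E G)
    (n : N) : X.conjAct (X.inl n) = MulAut.conj n := by
  ext m
  apply X.inl_injective
  rw [inl_conjAct_comm]
  simp

theorem conjAct_inr {N G : Type*} [Group N] [Group G] (φ : G →* MulAut N) (g : G) :
    (SemidirectProduct.toGroupExtension φ).conjAct (SemidirectProduct.inr g) = φ g := by
  ext m
  apply (SemidirectProduct.toGroupExtension φ).inl_injective
  rw [inl_conjAct_comm]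
  rw [← map_inv]
  exact (SemidirectProduct.inl_aut g m).symm

/-- Equivalent extensions have the same conjugation action on the kernel, even after a pullback. -/
theorem conjAct_pullback_equiv {N E F S G : Type*} [Group N] [Group E] [Group F] [Group S]
    [Group G] {X : GroupExtension N E G} {Y : GroupExtension N F S} {ι : G →* S}
    (f : X.Equiv (Y.pullback ι)) (e : E) : Y.conjAct (f e).1.1 = X.conjAct e := by
  ext m
  apply Y.inl_injective
  rw [inl_conjAct_comm]
  have h1 (n : N) : ((f (X.inl n)).1.1 : F) = Y.inl n := by rw [Equiv.map_inl]; rfl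
  rw [← h1, ← h1, inl_conjAct_comm, map_mul, map_mul, map_inv]
  rfl

/-- If a homomorphism `ρ` from `Aut N` to `G` kills the inner automorphisms and retracts the
conjugation action of an extension of `G` by `N`, then the extension is a pullback along `ι`
only if `ι` has a retraction. -/
theorem exists_retraction_of_isPullbackOf {N E F S G : Type*} [Group N] [Group E] [Group F]
    [Group S] [Group G] {X : GroupExtension N E G} {Y : GroupExtension N F S} {ι : G →* S}
    (ρ : MulAut N →* G) (hconj : ∀ n, ρ (MulAut.conj n) = 1)
    (hρ : ∀ g, ∃ e, X.rightHom e = g ∧ ρ (X.conjAct e) = g) (h : X.IsPullbackOf Y ι) :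
    ∃ r : S →* G, r.comp ι = MonoidHom.id G := by
  obtain ⟨f⟩ := h
  have hker : Y.rightHom.ker ≤ (ρ.comp Y.conjAct).ker := by
    rw [← Y.range_inl_eq_ker_rightHom]
    rintro _ ⟨n, rfl⟩
    rw [MonoidHom.mem_ker, MonoidHom.comp_apply, conjAct_inl, hconj]
  have hinv := Function.rightInverse_surjInv Y.rightHom_surjective
  refine ⟨Y.rightHom.liftOfRightInverse _ hinv ⟨ρ.comp Y.conjAct, hker⟩, ?_⟩
  ext g
  obtain ⟨e, he, hg⟩ := hρ g
  have h1 : Y.rightHom (f e).1.1 = ι g := by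
    have h2 : (f e).1.2 = g := by rw [← he, ← f.rightHom_map e]; rfl
    rw [← h2]
    exact (f e).2
  rw [MonoidHom.comp_apply, ← h1, MonoidHom.liftOfRightInverse_comp_apply]
  simp only [MonoidHom.comp_apply, MonoidHom.id_apply]
  rw [conjAct_pullback_equiv, hg]

end GroupExtension

/-! ### Uniqueness of the kernel. -/

/-- A normal subgroup of order coprime to its index is the only subgroup isomorphic to it. -/
theorem SemidirectProduct.eq_range_inl_of_coprime {N G : Type*} [Group N] [Group G] [Finite N]
    [Finite G] (φ : G →* MulAut N) (hc : (Nat.card N).Coprime (Nat.card G))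
    (H : Subgroup (N ⋊[φ] G)) (e : H ≃* N) :
    H = (SemidirectProduct.inl : N →* N ⋊[φ] G).range := by
  have : Finite (N ⋊[φ] G) := Finite.of_equiv _ SemidirectProduct.equivProd.symm
  apply Subgroup.eq_of_le_of_card_ge
  · intro h hh
    -- The image of `h` in `G` has order dividing both `|N|` and `|G|`.
    rw [SemidirectProduct.range_inl_eq_ker_rightHom, MonoidHom.mem_ker, ← orderOf_eq_one_iff]
    refine Nat.eq_one_of_dvd_coprimes hc ?_ (orderOf_dvd_natCard _)
    rw [← Nat.card_congr e.toEquiv]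
    exact (orderOf_map_dvd _ h).trans (H.orderOf_dvd_natCard hh)
  · rw [Nat.card_congr e.toEquiv,
      ← Nat.card_congr (MonoidHom.ofInjective SemidirectProduct.inl_injective).toEquiv]

/-! ### The kernel built from the Cayley graph. -/

/-- The semidirect product of `∏ x c, ZMod (p c)` by the torus `G → ZMod q`, where `a` acts on
the coordinate `(x, c)` through the weight `a x + 2 * a (x * c)`: the coordinates are the edges of
the Cayley graph of `G`, and the characteristic `p c` records the colour `c` of an edge. -/
@[ext]
structure CayleyWeightGroup {G : Type u} {q : ℕ} {p : G → ℕ}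
    (ε : ∀ c, AddChar (ZMod q) (ZMod (p c))) where
  /-- The unipotent coordinates. -/
  vec : G → ∀ c, ZMod (p c)
  /-- The torus coordinates. -/
  tor : G → ZMod q

namespace CayleyWeightGroup

variable {G : Type u} {q : ℕ} {p : G → ℕ} {ε : ∀ c, AddChar (ZMod q) (ZMod (p c))}

/-- The underlying product of a `CayleyWeightGroup`. -/
def equivProd : CayleyWeightGroup ε ≃ (G → ∀ c, ZMod (p c)) × (G → ZMod q) where
  toFun v := (v.vec, v.tor)
  invFun z := ⟨z.1, z.2⟩

theorem finite [Finite G] (hq : q ≠ 0) (hp : ∀ c, p c ≠ 0) : Finite (CayleyWeightGroup ε) := by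
  have := NeZero.mk hq
  have (c : G) := NeZero.mk (hp c)
  exact Finite.of_equiv _ equivProd.symm

theorem coprime_card [Finite G] {m : ℕ} (hq : q.Coprime m) (hp : ∀ c, (p c).Coprime m) :
    (Nat.card (CayleyWeightGroup ε)).Coprime m := by
  have := Fintype.ofFinite G
  simp only [Nat.card_congr equivProd, Nat.card_prod, Nat.card_pi, Nat.card_zmod]
  exact Nat.Coprime.mul_left
    (Nat.Coprime.prod_left fun _ _ => Nat.Coprime.prod_left fun c _ => hp c)
    (Nat.Coprime.prod_left fun _ _ => hq)

instance : One (CayleyWeightGroup ε) where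
  one := ⟨0, 0⟩

theorem vec_one : (1 : CayleyWeightGroup ε).vec = 0 := rfl

theorem tor_one : (1 : CayleyWeightGroup ε).tor = 0 := rfl

variable [Group G]

/-- The weight of the torus on the edge `(x, c)`. -/
def weight (a : G → ZMod q) (x c : G) : ZMod q := a x + 2 * a (x * c)

theorem weight_zero (x c : G) : weight (0 : G → ZMod q) x c = 0 := by simp [weight]

theorem weight_add (a b : G → ZMod q) (x c : G) :
    weight (a + b) x c = weight a x c + weight b x c := by
  simp only [weight, Pi.add_apply]; ring

theorem weight_neg (a : G → ZMod q) (x c : G) : weight (-a) x c = -weight a x c := by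
  simp only [weight, Pi.neg_apply]; ring

instance : Mul (CayleyWeightGroup ε) where
  mul v w := ⟨fun x c => v.vec x c + ε c (weight v.tor x c) * w.vec x c, v.tor + w.tor⟩

instance : Inv (CayleyWeightGroup ε) where
  inv v := ⟨fun x c => -(ε c (-weight v.tor x c) * v.vec x c), -v.tor⟩

theorem vec_mul (v w : CayleyWeightGroup ε) (x c : G) :
    (v * w).vec x c = v.vec x c + ε c (weight v.tor x c) * w.vec x c := rfl

theorem tor_mul (v w : CayleyWeightGroup ε) : (v * w).tor = v.tor + w.tor := rfl

theorem vec_inv (v : CayleyWeightGroup ε) (x c : G) :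
    v⁻¹.vec x c = -(ε c (-weight v.tor x c) * v.vec x c) := rfl

theorem tor_inv (v : CayleyWeightGroup ε) : v⁻¹.tor = -v.tor := rfl

instance : Group (CayleyWeightGroup ε) := Group.ofLeftAxioms
  (fun u v w => by
    ext x c
    · simp only [vec_mul, tor_mul, weight_add, AddChar.map_add_eq_mul]; ring
    · simp only [tor_mul, add_assoc])
  (fun v => by
    ext x c
    · simp [vec_mul, vec_one, tor_one, weight_zero]
    · simp [tor_mul, tor_one])
  (fun v => by
    ext x c
    · simp [vec_mul, vec_inv, tor_inv, weight_neg, vec_one]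
    · simp [tor_mul, tor_inv, tor_one])

theorem tor_pow (v : CayleyWeightGroup ε) (k : ℕ) : (v ^ k).tor = k • v.tor := by
  induction k with
  | zero => simp [tor_one]
  | succ k ih => rw [pow_succ, tor_mul, ih, succ_nsmul]

theorem vec_pow_of_tor_eq_zero (v : CayleyWeightGroup ε) (hv : v.tor = 0) (k : ℕ) :
    (v ^ k).vec = k • v.vec := by
  induction k with
  | zero => simp [vec_one]
  | succ k ih =>
    funext x c
    rw [pow_succ, vec_mul, tor_pow, hv, smul_zero, weight_zero, AddChar.map_zero_eq_one, ih,
      succ_nsmul, one_mul]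
    rfl

/-- The action of `G` by left translation. -/
def translate : G →* MulAut (CayleyWeightGroup ε) where
  toFun g :=
    { toFun := fun v => ⟨fun x => v.vec (g⁻¹ * x), fun x => v.tor (g⁻¹ * x)⟩
      invFun := fun v => ⟨fun x => v.vec (g * x), fun x => v.tor (g * x)⟩
      left_inv := fun v => by simp
      right_inv := fun v => by simp
      map_mul' := fun v w => by
        ext x c
        · simp [vec_mul, weight, mul_assoc]
        · simp [tor_mul] }
  map_one' := by ext v <;> simp
  map_mul' g h := by ext v <;> simp [mul_assoc]

theorem tor_translate (g : G) (v : CayleyWeightGroup ε) (x : G) :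
    (translate g v).tor x = v.tor (g⁻¹ * x) := rfl

/-! ### Rigidity of the automorphisms. -/

/-- An automorphism permutes the weights of each colour. -/
theorem exists_weight_apply_eq (hp : ∀ c, (p c).Prime) (hinj : Function.Injective p)
    (hpq : ∀ c, (p c).Coprime q) (hε : ∀ c, Function.Injective (ε c))
    (φ : MulAut (CayleyWeightGroup ε)) (x c : G) :
    ∃ y, ∀ n, weight (φ n).tor y c = weight n.tor x c := by
  classical
  have (c : G) := Fact.mk (hp c)
  -- A weight vector for the edge `(x, c)`: every `n` conjugates it to a power of itself, and `φ`
  -- preserves this relation.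
  let w : CayleyWeightGroup ε := ⟨Pi.single x (Pi.single c 1), 0⟩
  have hw0 : w.tor = 0 := rfl
  have hwp : w ^ p c = 1 := by
    ext y d
    · rw [vec_pow_of_tor_eq_zero w hw0]
      change p c • (Pi.single x (Pi.single c (1 : ZMod (p c))) : G → ∀ c, ZMod (p c)) y d = 0
      by_cases hy : y = x
      · subst hy
        by_cases hd : d = c
        · subst hd; simp
        · simp [hd]
      · simp [hy]
    · rw [tor_pow, hw0]; simp [tor_one]
  have hconj (n : CayleyWeightGroup ε) :
      n * w = w ^ (ε c (weight n.tor x c)).val * n := by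
    ext y d
    · rw [vec_mul, vec_mul, tor_pow, hw0, smul_zero, weight_zero, AddChar.map_zero_eq_one, one_mul,
        add_comm, vec_pow_of_tor_eq_zero w hw0]
      congr 1
      change _ * (Pi.single x (Pi.single c (1 : ZMod (p c))) : G → ∀ c, ZMod (p c)) y d =
        (ε c (weight n.tor x c)).val • (Pi.single x (Pi.single c (1 : ZMod (p c))) : G → ∀ c, ZMod (p c)) y d
      by_cases hy : y = x
      · subst hy
        by_cases hd : d = c
        · subst hd; simp
        · simp [hd]
      · simp [hy]
    · rw [tor_mul, tor_mul, tor_pow, hw0]; simp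
  have hw1 : w ≠ 1 := by
    intro h
    have h1 : w.vec x c = 0 := by rw [h]; rfl
    simp [w] at h1
  set v := φ w with hv
  have hvp : v ^ p c = 1 := by rw [hv, ← map_pow, hwp, map_one]
  have hv1 : v ≠ 1 := fun h => hw1 (φ.injective (h.trans (map_one φ).symm))
  have hv0 : v.tor = 0 := by
    have h1 : p c • v.tor = 0 := by rw [← tor_pow, hvp, tor_one]
    funext y
    have h2 : (p c : ZMod q) * v.tor y = 0 := by
      rw [← nsmul_eq_mul]; exact congrFun h1 y
    exact (ZMod.isUnit_iff_coprime _ _).2 (hpq c) |>.mul_right_eq_zero.1 h2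
  obtain ⟨y, d, hyd⟩ : ∃ y d, v.vec y d ≠ 0 := by
    by_contra! h
    exact hv1 (CayleyWeightGroup.ext (funext fun y => funext fun d => h y d) hv0)
  -- The order of `v` divides `p c`, so only coordinates of colour `c` survive.
  have hdc : d = c := by
    have h1 : p c • v.vec = 0 := by rw [← vec_pow_of_tor_eq_zero v hv0, hvp, vec_one]
    have h2 : (p c : ZMod (p d)) * v.vec y d = 0 := by
      rw [← nsmul_eq_mul]; exact congrFun (congrFun h1 y) d
    have h3 := (mul_eq_zero.1 h2).resolve_right hyd
    rw [ZMod.natCast_eq_zero_iff] at h3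
    exact hinj ((Nat.prime_dvd_prime_iff_eq (hp d) (hp c)).1 h3)
  subst hdc
  refine ⟨y, fun n => hε d (mul_right_cancel₀ hyd ?_)⟩
  have h1 : φ n * v = v ^ (ε d (weight n.tor x d)).val * φ n := by
    rw [hv, ← map_mul, hconj, map_mul, map_pow]
  have h2 := congrArg (fun z => z.vec y d) h1
  simp only [vec_mul, tor_pow, hv0, smul_zero, weight_zero, AddChar.map_zero_eq_one, one_mul,
    vec_pow_of_tor_eq_zero v hv0] at h2
  rw [add_comm, add_right_cancel_iff] at h2
  rw [h2]
  simp

/-- The weight `a s + 2 * a t` with `s ≠ t` determines the pair `(s, t)`. -/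
theorem eq_of_weights_eq {α R : Type*} [CommRing R] [Nontrivial R] (h2 : (2 : R) ≠ 0)
    (h3 : (3 : R) ≠ 0) {s t s' t' : α} (hst : s ≠ t)
    (h : ∀ a : α → R, a s + 2 * a t = a s' + 2 * a t') : s = s' ∧ t = t' := by
  classical
  -- The distinct coefficients 1 and 2 orient the edge: indicator functions detect its two ends.
  have h1 := h (Pi.single s 1)
  have h4 := h (Pi.single t 1)
  simp only [Pi.single_apply, hst, hst.symm, if_true, if_false] at h1 h4
  by_cases e1 : s' = s <;> by_cases e2 : t' = s <;> by_cases e3 : s' = t <;>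
    by_cases e4 : t' = t <;> grind

/-- An automorphism permutes the torus coordinates by a left translation. -/
theorem exists_tor_apply_eq [Fact q.Prime] (hq : 3 < q) (hp : ∀ c, (p c).Prime)
    (hinj : Function.Injective p) (hpq : ∀ c, (p c).Coprime q)
    (hε : ∀ c, Function.Injective (ε c)) (φ : MulAut (CayleyWeightGroup ε)) :
    ∃ s : G, ∀ n x, (φ n).tor (s * x) = n.tor x := by
  have h2 : (2 : ZMod q) ≠ 0 := fun h =>
    absurd (Nat.le_of_dvd (by norm_num) ((ZMod.natCast_eq_zero_iff 2 q).1 h)) (by omega)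
  have h3 : (3 : ZMod q) ≠ 0 := fun h =>
    absurd (Nat.le_of_dvd (by norm_num) ((ZMod.natCast_eq_zero_iff 3 q).1 h)) (by omega)
  choose σ hσ using exists_weight_apply_eq hp hinj hpq hε φ
  -- Colour `1` consists of loops, of weight `3 * a x`; cancelling 3 isolates a vertex.
  have ht (x : G) (n) : (φ n).tor (σ x 1) = n.tor x := by
    have h := hσ x 1 n
    simp only [weight, mul_one] at h
    apply mul_left_cancel₀ h3
    linear_combination h
  refine ⟨σ 1 1, fun n x => ?_⟩
  rw [← ht x]
  congr 1
  by_cases hx : x = 1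
  · rw [hx, mul_one]
  -- The edge of colour `x` from `1` to `x` goes to an edge of the same colour, joining the images
  -- of its ends.
  have key : σ 1 x = σ 1 1 ∧ σ 1 x * x = σ x 1 := by
    refine eq_of_weights_eq h2 h3 (fun h => hx (left_eq_mul.1 h)) fun a => ?_
    have h := hσ 1 x (φ.symm ⟨0, a⟩)
    rw [weight, weight, one_mul, ← ht 1, ← ht x, MulEquiv.apply_symm_apply] at h
    exact h
  rw [← key.1, key.2]

/-- Uniqueness of the translation makes its choice multiplicative in `φ`. -/
theorem eq_of_tor_apply_eq [Nontrivial (ZMod q)] {φ : MulAut (CayleyWeightGroup ε)} {s t : G}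
    (hs : ∀ n x, (φ n).tor (s * x) = n.tor x) (ht : ∀ n x, (φ n).tor (t * x) = n.tor x) :
    s = t := by
  classical
  have h := (hs (φ.symm ⟨0, Pi.single s 1⟩) 1).trans (ht _ 1).symm
  simp only [MulEquiv.apply_symm_apply, mul_one, Pi.single_apply, if_true] at h
  by_contra hne
  rw [if_neg (Ne.symm hne)] at h
  exact one_ne_zero h

/-- Automorphisms map to `G`, trivially on inner automorphisms and identically on translations. -/
theorem exists_retraction [Fact q.Prime] (hq : 3 < q) (hp : ∀ c, (p c).Prime)
    (hinj : Function.Injective p) (hpq : ∀ c, (p c).Coprime q)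
    (hε : ∀ c, Function.Injective (ε c)) :
    ∃ ρ : MulAut (CayleyWeightGroup ε) →* G,
      (∀ n, ρ (MulAut.conj n) = 1) ∧ ∀ g, ρ (translate g) = g := by
  choose s hs using exists_tor_apply_eq hq hp hinj hpq hε
  refine ⟨MonoidHom.mk' s fun φ ψ => ?_, fun n => ?_, fun g => ?_⟩
  · refine eq_of_tor_apply_eq (hs _) fun n x => ?_
    rw [MulAut.mul_apply, mul_assoc, hs, hs]
  · refine eq_of_tor_apply_eq (hs _) fun m x => ?_
    simp [MulAut.conj_apply, tor_mul, tor_inv]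
  · refine eq_of_tor_apply_eq (hs _) fun m x => ?_
    simp [tor_translate]

end CayleyWeightGroup

/-! ### Choice of primes and conclusion. -/

theorem ZMod.exists_injective_addChar {q p : ℕ} [Fact q.Prime] [Fact p.Prime]
    (h : p ≡ 1 [MOD q]) : ∃ e : AddChar (ZMod q) (ZMod p), Function.Injective e := by
  have hdvd : q ∣ Nat.card (ZMod p)ˣ := by
    rw [Nat.card_eq_fintype_card, ZMod.card_units]
    exact (Nat.modEq_iff_dvd' (Fact.out : p.Prime).one_le).1 h.symm
  obtain ⟨u, hu⟩ := exists_prime_orderOf_dvd_card' q hdvd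
  have hζ : IsPrimitiveRoot (u : ZMod p) q :=
    IsPrimitiveRoot.coe_units_iff.2 (hu ▸ IsPrimitiveRoot.orderOf u)
  refine ⟨AddChar.zmodChar q hζ.pow_eq_one, fun a b hab => ZMod.val_injective q ?_⟩
  rw [AddChar.zmodChar_apply, AddChar.zmodChar_apply] at hab
  exact hζ.pow_inj (ZMod.val_lt a) (ZMod.val_lt b) hab

theorem Nat.exists_injective_primes_modEq_one (α : Type*) [Finite α] {q : ℕ} (hq : q ≠ 0)
    (m : ℕ) : ∃ p : α → ℕ, Function.Injective p ∧
      ∀ a, (p a).Prime ∧ m < p a ∧ p a ≡ 1 [MOD q] := by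
  have hinf : {p : ℕ | p.Prime ∧ m < p ∧ p ≡ 1 [MOD q]}.Infinite := by
    refine Set.infinite_of_forall_exists_gt fun a => ?_
    obtain ⟨p, hp, hlt, hmod⟩ := Nat.exists_prime_gt_modEq_one (max a m) hq
    exact ⟨p, ⟨hp, (le_max_right _ _).trans_lt hlt, hmod⟩, (le_max_left _ _).trans_lt hlt⟩
  have := hinf.to_subtype
  let f : α → {p : ℕ | p.Prime ∧ m < p ∧ p ≡ 1 [MOD q]} :=
    fun a => Infinite.natEmbedding _ (Finite.equivFin α a : ℕ)
  exact ⟨fun a => f a, fun a b hab => (Finite.equivFin α).injective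
    (Fin.ext ((Infinite.natEmbedding _).injective (Subtype.ext hab))), fun a => (f a).2⟩

theorem mainTheorem5 (G : Type u) [Group G] [Finite G] :
    ∃ (N Gt : Type u) (_ : Group N) (_ : Group Gt) (_ : Finite Gt)
      (X : GroupExtension N Gt G),
      (∀ (S : Type v) [Group S] [Finite S] (ι : G →* S), Function.Injective ι →
        ((∃ (St : Type (max u v)) (_ : Group St) (Y : GroupExtension N St S),
            X.IsPullbackOf Y ι) ↔
          ∃ r : S →* G, r.comp ι = MonoidHom.id G)) ∧
      ∀ H : Subgroup Gt, Nonempty (H ≃* N) → H = X.inl.range := by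
  -- The bound 3 makes 2 and 3 nonzero mod `q`; primes above `|G|` give coprimality, and `p c ≡ 1`
  -- mod `q` provides the injective characters.
  obtain ⟨q, hq, hqp⟩ := Nat.exists_infinite_primes (max 3 (Nat.card G) + 1)
  have hq3 : 3 < q := (Nat.lt_succ_of_le (le_max_left _ _)).trans_le hq
  have hqG : Nat.card G < q := (Nat.lt_succ_of_le (le_max_right _ _)).trans_le hq
  have := Fact.mk hqp
  obtain ⟨p, hinj, hp⟩ := Nat.exists_injective_primes_modEq_one G hqp.ne_zero (Nat.card G)
  have (c : G) := Fact.mk (hp c).1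
  choose ε hε using fun c => ZMod.exists_injective_addChar (hp c).2.2
  have hpq (c : G) : (p c).Coprime q := by
    rw [Nat.Coprime, (hp c).2.2.gcd_eq, Nat.gcd_one_left]
  obtain ⟨ρ, hρconj, hρ⟩ :=
    CayleyWeightGroup.exists_retraction hq3 (fun c => (hp c).1) hinj hpq hε
  have hfin : Finite (CayleyWeightGroup ε) :=
    CayleyWeightGroup.finite hqp.ne_zero fun c => (hp c).1.ne_zero
  have hcop : (Nat.card (CayleyWeightGroup ε)).Coprime (Nat.card G) :=
    CayleyWeightGroup.coprime_card (Nat.coprime_of_lt_prime Nat.card_pos.ne' hqG hqp)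
      fun c => (Nat.coprime_of_lt_prime Nat.card_pos.ne' (hp c).2.1 (hp c).1)
  let φ : G →* MulAut (CayleyWeightGroup ε) := CayleyWeightGroup.translate
  refine ⟨CayleyWeightGroup ε, CayleyWeightGroup ε ⋊[φ] G, inferInstance, inferInstance,
    Finite.of_equiv _ SemidirectProduct.equivProd.symm, SemidirectProduct.toGroupExtension φ,
    fun S _ _ ι _ => ⟨?_, ?_⟩, ?_⟩
  · rintro ⟨St, _, Y, h⟩
    refine GroupExtension.exists_retraction_of_isPullbackOf ρ hρconj (fun g => ?_) h
    exact ⟨SemidirectProduct.inr g, SemidirectProduct.rightHom_inr g, by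
      rw [GroupExtension.conjAct_inr]; exact hρ g⟩
  · rintro ⟨r, hr⟩
    exact ⟨_, inferInstance, (SemidirectProduct.toGroupExtension φ).pullback r,
      GroupExtension.isPullbackOf_pullback_of_comp_eq_id _ ι r hr⟩
  · rintro H ⟨e⟩
    exact SemidirectProduct.eq_range_inl_of_coprime φ hcop H e
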